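/- **Definitions.** A partition $\pi=(\lambda_1\ge\lambda_2\ge\dots\ge\lambda_r)$ is a finite (possibly empty) non-increasing sequence of positive integers. Fill the boxes of its Ferrers diagram as follows: the odd-indexed rows (first, third, ...) read $a,b,a,b,\dots$ and the even-indexed rows read $c,d,c,d,\dots$ from left to right. The weight is $\omega_\pi(a,b,c,d)=a^{\#a}b^{\#b}c^{\#c}d^{\#d}$, where $\#a$ is the number of boxes labelled $a$, and so on. For non-negative integers $L,R$ let $$\Phi_{L,R}(a,b,c,d)=\sum_{\pi}\omega_\pi(a,b,c,d),$$ the sum being over all partitions $\pi$ whose parts are all $\le L$ and which have at most $R$ parts. Further, $(x;q)_n=\prod_{i=0}^{n-1}(1-xq^i)$, and $\begin{bmatrix}k\\n\end{bmatrix}_q=\frac{(q;q)_k}{(q;q)_n(q;q)_{k-n}}$ if $k\ge n\ge 0$, and $0$ otherwise. **Theorem.** Let $\nu,\mu\in\{0,1\}$ with $(\nu,\mu)\ne(1,0)$, and let $N,M\ge 0$ be integers such that $2N+\nu$ and $2M+\mu$ are positive. Then, with $Q=abcd$, $$\begin{aligned} \Phi_{2N+\nu,2M+\mu}(a,b,c,d)={}&\sum_{k=0}^{M}(ac)^k\begin{bmatrix}N+k-1+\nu\\k\end{bmatrix}_Q\sum_{j=0}^{N}(ab)^{N-j}\\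 &\times\left(\sum_{m_1=0}^{j}(1+\nu\mu a)\,a^{m_1}Q^{\binom{m_1}{2}+\nu\mu m_1}\begin{bmatrix}M-k+\mu-\nu\\m_1\end{bmatrix}_Q\begin{bmatrix}M-k+j-m_1\\j-m_1\end{bmatrix}_Q\right)\\ &\times\left(\sum_{m_2=0}^{N-j}c^{m_2}Q^{\binom{m_2}{2}}\begin{bmatrix}M-k\\m_2\end{bmatrix}_Q\frac{(Q^{M-k+\mu};Q)_{N-j-m_2}}{(Q;Q)_{N-j-m_2}}\right). \end{aligned}$$ Here $a,b,c,d$ are any elements of any field such that $Q^n\ne 1$ for $1\le n\le N+M$ (so that no denominator vanishes); in particular they may be independent indeterminates. -/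

import Mathlib

/-- The finite `q`-shifted factorial `(x; q)_L = ∏_{n < L} (1 - x qⁿ)`. -/
def qPoch {K : Type*} [Field K] (x q : K) (L : ℕ) : K :=
  ∏ n ∈ Finset.range L, (1 - x * q ^ n)

/-- The Gaussian binomial coefficient `[k; n]_q`, equal to `(q; q)_k / ((q; q)_n (q; q)_{k-n})`
for `n ≤ k` and to `0` otherwise. -/
def gaussBinom {K : Type*} [Field K] (q : K) (k n : ℕ) : K :=
  if n ≤ k then qPoch q q k / (qPoch q q n * qPoch q q (k - n)) else 0

/-- A partition: a non-increasing finite sequence of positive integers. -/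
def IsPart (p : List ℕ) : Prop :=
  p.Pairwise (fun x y => y ≤ x) ∧ ∀ x ∈ p, 0 < x

/-- The partitions all of whose parts are at most `L` and which have at most `R` parts. -/
def boundedParts (L R : ℕ) : Set (List ℕ) :=
  {p | IsPart p ∧ (∀ x ∈ p, x ≤ L) ∧ p.length ≤ R}

theorem boundedParts_finite (L R : ℕ) : (boundedParts L R).Finite := by
  refine ((List.finite_length_le (Fin (L + 1)) R).image (List.map Fin.val)).subset ?_
  rintro p ⟨-, hL, hR⟩
  refine ⟨p.map (Fin.ofNat (L + 1)), by simpa using hR, ?_⟩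
  rw [List.map_map]
  conv_rhs => rw [← List.map_id p]
  refine List.map_congr_left fun x hx => ?_
  have := hL x hx
  simp [Fin.ofNat, Nat.mod_eq_of_lt (Nat.lt_succ_of_le this)]

/-- The label of the box in row `i` and column `j` (both counted from `0`) of the four-variable
decoration: the first, third, … rows read `a, b, a, b, …`, the second, fourth, … rows read
`c, d, c, d, …`. -/
def boxLabel {K : Type*} (a b c d : K) (i j : ℕ) : K :=
  if Even i then (if Even j then a else b) else (if Even j then c else d)

/-- The Boulet–Stanley weight `ω_p(a, b, c, d)`: the product of the labels of all boxes of the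
decorated Ferrers diagram of `p`, that is `a ^ #a * b ^ #b * c ^ #c * d ^ #d`. -/
def bsWeight {K : Type*} [Field K] (a b c d : K) (p : List ℕ) : K :=
  ∏ i : Fin p.length, ∏ j ∈ Finset.range (p.get i), boxLabel a b c d i j

/-- `Φ_{L,R}(a, b, c, d)`: the weighted count of the partitions into parts `≤ L` with at most
`R` parts. -/
noncomputable def boundedPhi {K : Type*} [Field K] (L R : ℕ) (a b c d : K) : K :=
  ∑ p ∈ (boundedParts_finite L R).toFinset, bsWeight a b c d p

/-!
Write `(a, b, c, d) ↦ (c, d, a, b)` as a bar; it fixes `Q = abcd`. Deleting a first row of maximal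
length gives the recursion
`Φ_(L+1,R+1) = Φ_(L,R+1) + w_(L+1) * bar Φ_(L+1,R)`, with `w_L` the weight of a first row of
length `L`, and this together with `Φ_(0,R) = Φ_(L,0) = 1` determines `Φ`. So it is enough to guess
`Φ` for each pair of parities of `L` and `R` and to check the recursion.

The guess is made of generating functions. In a variable `z` marking `N`, let
`p_m = (-az)_m (-abcz)_m / ((z)_(m+1) (abz)_m)` (`evenSeries`) and
`t_m = (-aQz)_m (-abcz)_m / ((z)_(m+1) (abz)_(m+1))` (`oddSeries`), all products to base `Q`. For a
fixed `N`, the coefficients of `z^N` in `p_m`, `t_m` and `(1 + az) t_m` are collected over all `m`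
in a power series in a second variable `y` marking `M` (`coeffSeries`). Multiplying it by
`1 / (acy)_N` or `1 / (acy)_(N+1)` produces the sum over `k` in the theorem, so that
`Φ_(2N,2M)`, `Φ_(2N,2M+1)` and `Φ_(2N+1,2M+1)` are claimed to be the coefficients of `y^M` in
`[z^N] p / (acy)_N`, `[z^N] (1 + az) t / (acy)_N` and `(1 + a) [z^N] t / (acy)_(N+1)`. The fourth
family, `Φ_(2N+1,2M)`, is defined by the recursion itself (`phiOddEven`), which leaves three
relations to check. They come down to two identities of power series in `z`,
`(1 - z) t_m(z) = bar p_m(abz)` (`one_sub_X_mul_oddSeries`) and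
`(1 - z) p_(m+1)(z) + ac z p_m(Qz) = (1 + (abc + a + ac) z) bar t_m(abz)`
(`one_sub_X_mul_evenSeries_succ`), which are immediate from the product formulas.

The explicit sums of the theorem are the coefficients of these products. The factors
`(-xz)_n` and `1 / (z)_s` are entered through their `q`-binomial expansions, with Gaussian binomials
defined by the Pascal rule, so that the argument is valid in every field and for every `Q`; the
hypothesis on roots of unity serves only to pass to the quotients of `q`-factorials.
-/

section

open PowerSeries

variable {K : Type*} [Field K]

/-! ### Gaussian binomial coefficients by the Pascal rule -/

/-- The Gaussian binomial coefficient as a polynomial in `q`, defined by its Pascal rule. Unlike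
the quotient `gaussBinom`, it has the right value at roots of unity too. -/
def qBinom (q : K) : ℕ → ℕ → K
  | _, 0 => 1
  | 0, _ + 1 => 0
  | k + 1, n + 1 => qBinom q k n + q ^ (n + 1) * qBinom q k (n + 1)

@[simp] theorem qBinom_zero_right (q : K) (k : ℕ) : qBinom q k 0 = 1 := by
  cases k <;> rfl

theorem qBinom_succ_succ (q : K) (k n : ℕ) :
    qBinom q (k + 1) (n + 1) = qBinom q k n + q ^ (n + 1) * qBinom q k (n + 1) := rfl

theorem qBinom_eq_zero (q : K) {k n : ℕ} (h : k < n) : qBinom q k n = 0 := by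
  induction k generalizing n with
  | zero => obtain ⟨n, rfl⟩ := Nat.exists_eq_succ_of_ne_zero h.ne'; rfl
  | succ k ih =>
    obtain ⟨n, rfl⟩ := Nat.exists_eq_succ_of_ne_zero (Nat.ne_zero_of_lt h)
    rw [Nat.succ_eq_add_one, qBinom_succ_succ, ih (by omega), ih (by omega)]
    simp

@[simp] theorem qBinom_self (q : K) (k : ℕ) : qBinom q k k = 1 := by
  induction k with
  | zero => rfl
  | succ k ih => rw [qBinom_succ_succ, ih, qBinom_eq_zero q (Nat.lt_succ_self k)]; simp

/-- The second Pascal rule, with the power of `q` on the other term. -/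
theorem qBinom_succ_succ' (q : K) (s n : ℕ) :
    qBinom q (s + n + 1) (n + 1) = qBinom q (s + n) (n + 1) + q ^ s * qBinom q (s + n) n := by
  induction s generalizing n with
  | zero => simp [qBinom_eq_zero]
  | succ s ihs =>
    induction n with
    | zero =>
      have h := ihs 0
      have h1 := qBinom_succ_succ q (s + 1) 0
      have h2 := qBinom_succ_succ q s 0
      simp only [add_zero, zero_add, qBinom_zero_right, pow_one, mul_one] at h h1 h2 ⊢
      rw [h1]
      linear_combination q * h - h2
    | succ n ihn =>
      have h := ihs (n + 1)
      have h1 := qBinom_succ_succ q (s + 1 + (n + 1)) (n + 1)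
      have h2 := qBinom_succ_succ q (s + 1 + n) (n + 1)
      have h3 := qBinom_succ_succ q (s + 1 + n) n
      rw [show s + 1 + (n + 1) = s + 1 + n + 1 by ring] at *
      rw [show s + (n + 1) + 1 = s + 1 + n + 1 by ring, show s + (n + 1) = s + 1 + n by ring] at h
      rw [h1]
      linear_combination q ^ (n + 1 + 1) * h + ihn - h2 - q ^ (s + 1) * h3

theorem qPoch_succ (x q : K) (n : ℕ) : qPoch x q (n + 1) = qPoch x q n * (1 - x * q ^ n) :=
  Finset.prod_range_succ _ _

theorem qPoch_self_ne_zero {q : K} {n : ℕ} (h : ∀ i, 1 ≤ i → i ≤ n → q ^ i ≠ 1) :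
    qPoch q q n ≠ 0 := by
  refine Finset.prod_ne_zero_iff.2 fun i hi => ?_
  rw [← pow_succ', sub_ne_zero]
  exact (h (i + 1) (by omega) (by simpa using hi)).symm

theorem qPoch_pow_mul (q : K) (s n : ℕ) :
    qPoch q q s * qPoch (q ^ (s + 1)) q n = qPoch q q (s + n) := by
  rw [qPoch, qPoch, qPoch, Finset.prod_range_add]
  congr 1
  refine Finset.prod_congr rfl fun i _ => ?_
  ring

theorem qBinom_mul_qPoch (q : K) (n r : ℕ) :
    qBinom q (n + r) n * (qPoch q q n * qPoch q q r) = qPoch q q (n + r) := by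
  induction n generalizing r with
  | zero => simp [qPoch]
  | succ n ihn =>
    induction r with
    | zero => simp [qPoch]
    | succ r ihr =>
      have h1 := ihn (r + 1)
      rw [show n + 1 + (r + 1) = n + (r + 1) + 1 by ring, qBinom_succ_succ,
        qPoch_succ q q (n + (r + 1)), ← h1]
      rw [show n + 1 + r = n + (r + 1) by ring, ← h1] at ihr
      rw [qPoch_succ q q r, qPoch_succ q q n] at *
      linear_combination q ^ (n + 1) * (1 - q * q ^ r) * ihr

theorem gaussBinom_eq_qBinom {q : K} {k : ℕ} (n : ℕ) (h : ∀ i, 1 ≤ i → i ≤ k → q ^ i ≠ 1) :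
    gaussBinom q k n = qBinom q k n := by
  unfold gaussBinom
  split_ifs with hn
  · obtain ⟨r, rfl⟩ := Nat.exists_eq_add_of_le hn
    have h1 : qPoch q q n ≠ 0 := qPoch_self_ne_zero fun i hi hi' => h i hi (by omega)
    have h2 : qPoch q q r ≠ 0 := qPoch_self_ne_zero fun i hi hi' => h i hi (by omega)
    rw [Nat.add_sub_cancel_left, div_eq_iff (mul_ne_zero h1 h2), qBinom_mul_qPoch]
  · exact (qBinom_eq_zero q (by omega)).symm

theorem qPoch_div_eq_qBinom {q : K} {s n : ℕ} (h : ∀ i, 1 ≤ i → i ≤ s + n - 1 → q ^ i ≠ 1) :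
    qPoch (q ^ s) q n / qPoch q q n = qBinom q (s + n - 1) n := by
  cases s with
  | zero =>
    cases n with
    | zero => simp [qPoch]
    | succ n =>
      rw [qBinom_eq_zero q (by omega), div_eq_zero_iff]
      left
      exact Finset.prod_eq_zero (i := 0) (by simp) (by simp)
  | succ s =>
    rw [show s + 1 + n - 1 = n + s by omega] at *
    have h1 : qPoch q q n ≠ 0 := qPoch_self_ne_zero fun i hi hi' => h i hi (by omega)
    have h2 : qPoch q q s ≠ 0 := qPoch_self_ne_zero fun i hi hi' => h i hi (by omega)
    rw [div_eq_iff h1]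
    apply mul_left_cancel₀ h2
    rw [qPoch_pow_mul, add_comm s n, ← qBinom_mul_qPoch]
    ring

/-! ### The series of the `q`-binomial theorem -/

/-- The expansion of `(-xz; q)_n = ∏_{i < n} (1 + x qⁱ z)` given by the `q`-binomial theorem. -/
def qBinomSeries (q x : K) (n : ℕ) : K⟦X⟧ :=
  mk fun i => x ^ i * q ^ (i.choose 2) * qBinom q n i

/-- The expansion of `1 / (z; q)_s`. Truncated subtraction gives the right value `1` for `s = 0`:
the coefficient of `z^i` is then `[i - 1; i] = 0` if `0 < i`, and `[0; 0] = 1` if `i = 0`. -/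
def qGeomSeries (q : K) (s : ℕ) : K⟦X⟧ :=
  mk fun i => qBinom q (s + i - 1) i

theorem rescale_qBinomSeries (q x y : K) (n : ℕ) :
    rescale y (qBinomSeries q x n) = qBinomSeries q (y * x) n := by
  ext i
  simp only [qBinomSeries, coeff_rescale, coeff_mk, mul_pow]
  ring

theorem qBinomSeries_succ (q x : K) (n : ℕ) :
    qBinomSeries q x (n + 1) = (1 + C x * X) * qBinomSeries q (q * x) n := by
  ext i
  rw [add_mul, one_mul, mul_assoc, map_add, coeff_C_mul]
  cases i with
  | zero => simp [qBinomSeries]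
  | succ i =>
    simp only [coeff_succ_X_mul, qBinomSeries, coeff_mk, qBinom_succ_succ,
      Nat.choose_succ_succ' i 1, Nat.choose_one_right]
    ring

theorem one_sub_X_mul_qGeomSeries (q : K) (s : ℕ) :
    (1 - X) * qGeomSeries q (s + 1) = rescale q (qGeomSeries q s) := by
  ext i
  rw [sub_mul, one_mul, map_sub]
  cases i with
  | zero => simp [qGeomSeries]
  | succ i =>
    simp only [coeff_succ_X_mul, qGeomSeries, coeff_mk, coeff_rescale]
    rw [show s + 1 + (i + 1) - 1 = s + i + 1 by omega, show s + 1 + i - 1 = s + i by omega,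
      show s + (i + 1) - 1 = s + i by omega, qBinom_succ_succ]
    ring

theorem one_sub_pow_mul_X_mul_qGeomSeries (q : K) (s : ℕ) :
    (1 - C (q ^ s) * X) * qGeomSeries q (s + 1) = qGeomSeries q s := by
  ext i
  rw [sub_mul, one_mul, mul_assoc, map_sub, coeff_C_mul]
  cases i with
  | zero => simp [qGeomSeries]
  | succ i =>
    simp only [coeff_succ_X_mul, qGeomSeries, coeff_mk]
    rw [show s + 1 + (i + 1) - 1 = s + i + 1 by omega, show s + 1 + i - 1 = s + i by omega,
      show s + (i + 1) - 1 = s + i by omega, qBinom_succ_succ']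
    ring

/-! ### Removing a maximal first row -/

theorem bsWeight_nil (a b c d : K) : bsWeight a b c d [] = 1 := by simp [bsWeight]

/-- Below the first row the labels `a, b` and `c, d` change places. -/
theorem bsWeight_cons (a b c d : K) (x : ℕ) (p : List ℕ) :
    bsWeight a b c d (x :: p) =
      (∏ j ∈ Finset.range x, if Even j then a else b) * bsWeight c d a b p := by
  unfold bsWeight
  refine (Fin.prod_univ_succ (n := p.length) _).trans ?_
  refine congrArg (_ * ·) (Finset.prod_congr rfl fun i _ => Finset.prod_congr rfl fun j _ => ?_)
  by_cases h : Even (i : ℕ) <;> simp [boxLabel, Nat.even_add_one, h]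

theorem prod_range_two_mul_ite_even (a b : K) (n : ℕ) :
    (∏ j ∈ Finset.range (2 * n), if Even j then a else b) = (a * b) ^ n := by
  induction n with
  | zero => simp
  | succ n ih =>
    rw [show 2 * (n + 1) = 2 * n + 1 + 1 by ring, Finset.prod_range_succ, Finset.prod_range_succ,
      ih, if_pos (by simp), if_neg (by simp)]
    ring

theorem boundedPhi_zero_left (R : ℕ) (a b c d : K) : boundedPhi 0 R a b c d = 1 := by
  have : (boundedParts_finite 0 R).toFinset = {[]} := by
    ext p
    simp only [Set.Finite.mem_toFinset, Finset.mem_singleton]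
    constructor
    · rintro ⟨⟨-, h⟩, h', -⟩
      refine List.eq_nil_iff_forall_not_mem.2 fun x hx => ?_
      have := h x hx
      have := h' x hx
      omega
    · rintro rfl
      simp [boundedParts, IsPart]
  rw [boundedPhi, this, Finset.sum_singleton, bsWeight_nil]

theorem boundedPhi_zero_right (L : ℕ) (a b c d : K) : boundedPhi L 0 a b c d = 1 := by
  have : (boundedParts_finite L 0).toFinset = {[]} := by
    ext p
    simp only [Set.Finite.mem_toFinset, Finset.mem_singleton]
    constructor
    · rintro ⟨-, -, h⟩
      simpa using h
    · rintro rfl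
      simp [boundedParts, IsPart]
  rw [boundedPhi, this, Finset.sum_singleton, bsWeight_nil]

theorem mem_boundedParts_cons {L R x : ℕ} {p : List ℕ} :
    x :: p ∈ boundedParts L (R + 1) ↔ 0 < x ∧ x ≤ L ∧ p ∈ boundedParts x R := by
  simp only [boundedParts, IsPart, Set.mem_ofPred_eq, List.pairwise_cons, List.mem_cons,
    forall_eq_or_imp, List.length_cons, add_le_add_iff_right]
  constructor
  · rintro ⟨⟨⟨h1, h2⟩, h3, h4⟩, ⟨h5, h6⟩, h7⟩
    exact ⟨h3, h5, ⟨h2, h4⟩, h1, h7⟩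
  · rintro ⟨h3, h5, ⟨h2, h4⟩, h1, h7⟩
    exact ⟨⟨⟨h1, h2⟩, h3, h4⟩, ⟨h5, fun y hy => (h1 y hy).trans h5⟩, h7⟩

theorem nil_mem_boundedParts (L R : ℕ) : [] ∈ boundedParts L R := by
  simp [boundedParts, IsPart]

/-- The partitions counted on the left either have all parts `≤ L`, or their first part is `L + 1`
and the remaining rows form a partition with at most `R` parts, all `≤ L + 1`. -/
theorem boundedPhi_succ_succ (L R : ℕ) (a b c d : K) :
    boundedPhi (L + 1) (R + 1) a b c d = boundedPhi L (R + 1) a b c d +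
      (∏ j ∈ Finset.range (L + 1), if Even j then a else b) * boundedPhi (L + 1) R c d a b := by
  have hinj : Function.Injective (List.cons (L + 1)) := List.cons_injective
  have : (boundedParts_finite (L + 1) (R + 1)).toFinset =
      (boundedParts_finite L (R + 1)).toFinset.disjUnion
        ((boundedParts_finite (L + 1) R).toFinset.map ⟨List.cons (L + 1), hinj⟩) (by
          rw [Finset.disjoint_left]
          rintro p hp hq
          obtain ⟨q, -, rfl⟩ := Finset.mem_map.1 hq
          have := (mem_boundedParts_cons.1 ((Set.Finite.mem_toFinset _).1 hp)).2.1
          omega) := by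
    ext p
    simp only [Set.Finite.mem_toFinset, Finset.mem_disjUnion, Finset.mem_map,
      Function.Embedding.coeFn_mk]
    cases p with
    | nil => simp [nil_mem_boundedParts]
    | cons x p =>
      simp only [mem_boundedParts_cons, List.cons.injEq]
      constructor
      · rintro ⟨h1, h2, h3⟩
        rcases h2.lt_or_eq with h | rfl
        · exact Or.inl ⟨h1, by omega, h3⟩
        · exact Or.inr ⟨p, h3, rfl, rfl⟩
      · rintro (⟨h1, h2, h3⟩ | ⟨p, h, rfl, rfl⟩)
        · exact ⟨h1, by omega, h3⟩
        · exact ⟨by omega, le_rfl, h⟩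
  rw [boundedPhi, this, Finset.sum_disjUnion, Finset.sum_map, boundedPhi, boundedPhi,
    Finset.mul_sum]
  simp only [Function.Embedding.coeFn_mk, bsWeight_cons]

theorem boundedPhi_odd_succ (N R : ℕ) (a b c d : K) :
    boundedPhi (2 * N + 1) (R + 1) a b c d = boundedPhi (2 * N) (R + 1) a b c d +
      a * (a * b) ^ N * boundedPhi (2 * N + 1) R c d a b := by
  rw [boundedPhi_succ_succ, Finset.prod_range_succ, prod_range_two_mul_ite_even,
    if_pos (by simp), mul_comm a ((a * b) ^ N)]

theorem boundedPhi_even_succ (N R : ℕ) (a b c d : K) :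
    boundedPhi (2 * (N + 1)) (R + 1) a b c d = boundedPhi (2 * N + 1) (R + 1) a b c d +
      (a * b) ^ (N + 1) * boundedPhi (2 * (N + 1)) R c d a b := by
  rw [← prod_range_two_mul_ite_even, show 2 * (N + 1) = 2 * N + 1 + 1 by ring,
    boundedPhi_succ_succ]

/-! ### Two identities between product series -/

/-- The series `p_m = (-az; q)_m (-abcz; q)_m / ((z; q)_(m+1) (abz; q)_m)` in `z`; here
`q = abcd` is intended, but `q` is kept as a separate variable. -/
noncomputable def evenSeries (q a b c : K) (m : ℕ) : K⟦X⟧ :=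
  qBinomSeries q a m * qGeomSeries q (m + 1) *
    rescale (a * b) (qBinomSeries q c m * qGeomSeries q m)

/-- The series `t_m = (-aqz; q)_m (-abcz; q)_m / ((z; q)_(m+1) (abz; q)_(m+1))` in `z`. -/
noncomputable def oddSeries (q a b c : K) (m : ℕ) : K⟦X⟧ :=
  qBinomSeries q (q * a) m * qGeomSeries q (m + 1) *
    rescale (a * b) (qBinomSeries q c m * qGeomSeries q (m + 1))

/-- For a family `F` of series in `z`, the series in a second variable whose `m`-th coefficient is
the coefficient of `z^N` in `F m`. -/
noncomputable def coeffSeries (F : ℕ → K⟦X⟧) (N : ℕ) : K⟦X⟧ := mk fun m => coeff N (F m)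

/-- `(1 - z) t_m(z) = bar p_m(abz)`, where the bar is `(a, b, c, d) ↦ (c, d, a, b)`. -/
theorem one_sub_X_mul_oddSeries {q a b c d : K} (hq : q = a * b * c * d) (m : ℕ) :
    (1 - X) * oddSeries q a b c m = rescale (a * b) (evenSeries q c d a m) := by
  have hq' : c * d * (a * b) = q := by rw [hq]; ring
  simp only [oddSeries, evenSeries, map_mul, rescale_qBinomSeries, rescale_rescale]
  rw [hq', show a * b * (c * d * a) = q * a by rw [hq]; ring]
  linear_combination (qBinomSeries q (q * a) m * (qBinomSeries q (a * b * c) m *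
    rescale (a * b) (qGeomSeries q (m + 1)))) * one_sub_X_mul_qGeomSeries q m

theorem rescale_one_sub_X (y : K) : rescale y (1 - X : K⟦X⟧) = 1 - C y * X := by
  rw [map_sub, map_one, rescale_X]

/-- `(1 - z) p_(m+1)(z) + ac z p_m(qz) = (1 + (abc + a + ac) z) bar t_m(abz)`. After removing the
common factor `bar t_m(abz)`, this is
`(1 + az) (1 + abcz) + ac z (1 - abz) = 1 + (abc + a + ac) z`. -/
theorem one_sub_X_mul_evenSeries_succ {q a b c d : K} (hq : q = a * b * c * d) (m : ℕ) :
    (1 - X) * evenSeries q a b c (m + 1) + C (a * c) * X * rescale q (evenSeries q a b c m) =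
      (1 + C (a * b * c + a + a * c) * X) * rescale (a * b) (oddSeries q c d a m) := by
  have hq' : c * d * (a * b) = q := by rw [hq]; ring
  have h1 := one_sub_X_mul_qGeomSeries q (m + 1)
  have h2 := congrArg (rescale (a * b)) (one_sub_X_mul_qGeomSeries q m)
  rw [map_mul, rescale_one_sub_X, rescale_rescale] at h2
  simp only [oddSeries, evenSeries, map_mul, rescale_qBinomSeries, rescale_rescale]
  rw [hq', qBinomSeries_succ q a, qBinomSeries_succ q (a * b * c), mul_comm (a * b) q, ← h2,
    show a * b * (q * c) = q * (a * b * c) by ring,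
    show a * b * (c * d * a) = q * a by rw [hq]; ring]
  simp only [map_add, map_mul] at *
  linear_combination ((1 + C a * X) * qBinomSeries q (q * a) m * ((1 + C a * C b * C c * X) *
    qBinomSeries q (q * (a * b * c)) m *
    rescale (a * b) (qGeomSeries q (m + 1)))) * h1

/-! ### The four families of bounded generating functions -/

theorem coeff_zero_mul_eq (F G : K⟦X⟧) : coeff 0 (F * G) = coeff 0 F * coeff 0 G := by
  simp

/-- The generating function over `M` of `Φ_(2N,2M+1)`. -/
noncomputable def phiEvenOdd (q a b c : K) (N : ℕ) : K⟦X⟧ :=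
  coeffSeries (fun m => (1 + C a * X) * oddSeries q a b c m) N * rescale (a * c) (qGeomSeries q N)

/-- The generating function over `M` of `Φ_(2N+1,2M+1)`. -/
noncomputable def phiOddOdd (q a b c : K) (N : ℕ) : K⟦X⟧ :=
  C (1 + a) * coeffSeries (oddSeries q a b c) N * rescale (a * c) (qGeomSeries q (N + 1))

/-- The generating function over `M` of `Φ_(2N,2M)`. -/
noncomputable def phiEvenEven (q a b c : K) (N : ℕ) : K⟦X⟧ :=
  coeffSeries (evenSeries q a b c) N * rescale (a * c) (qGeomSeries q N)

/-- The generating function over `M` of `Φ_(2N+1,2M)`, expressed through two of the other families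
by the recursion for a maximal first row. -/
noncomputable def phiOddEven (q a b c d : K) (N : ℕ) : K⟦X⟧ :=
  phiEvenEven q a b c N + C (a * (a * b) ^ N) * X * phiOddOdd q c d a N

/-- `1 / (yz; q)_N = (1 - y q^N z) / (yz; q)_(N+1)`. -/
theorem rescale_qGeomSeries_eq (q y : K) (N : ℕ) :
    rescale y (qGeomSeries q N) =
      (1 - C (y * q ^ N) * X) * rescale y (qGeomSeries q (N + 1)) := by
  rw [← one_sub_pow_mul_X_mul_qGeomSeries q N, map_mul, map_sub, map_one, map_mul, rescale_X]
  congr 2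
  rw [← mul_assoc, show rescale y (C (q ^ N)) = C (q ^ N) from by
    ext n; rw [coeff_rescale, coeff_C]; split_ifs with h <;> simp [h], ← map_mul, mul_comm y]

theorem coeffSeries_oddSeries_succ {q a b c d : K} (hq : q = a * b * c * d) (N : ℕ) :
    coeffSeries (oddSeries q a b c) (N + 1) = coeffSeries (oddSeries q a b c) N +
      C ((a * b) ^ (N + 1)) * coeffSeries (evenSeries q c d a) (N + 1) := by
  ext m
  have h := congrArg (coeff (N + 1)) (one_sub_X_mul_oddSeries hq m)
  rw [sub_mul, one_mul, map_sub, coeff_succ_X_mul, coeff_rescale] at h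
  simp only [coeffSeries, map_add, coeff_C_mul, coeff_mk]
  linear_combination h

theorem coeffSeries_oddSeries_zero {q a b c d : K} (hq : q = a * b * c * d) :
    coeffSeries (oddSeries q a b c) 0 = coeffSeries (evenSeries q c d a) 0 := by
  ext m
  have h := congrArg (coeff 0) (one_sub_X_mul_oddSeries hq m)
  rw [sub_mul, one_mul, map_sub, coeff_rescale] at h
  simpa [coeffSeries] using h

theorem coeffSeries_one_add_mul_succ (a : K) (F : ℕ → K⟦X⟧) (N : ℕ) :
    coeffSeries (fun m => (1 + C a * X) * F m) (N + 1) =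
      coeffSeries F (N + 1) + C a * coeffSeries F N := by
  ext m
  simp [coeffSeries, add_mul, mul_assoc, coeff_succ_X_mul]

theorem coeffSeries_one_add_mul_zero (a : K) (F : ℕ → K⟦X⟧) :
    coeffSeries (fun m => (1 + C a * X) * F m) 0 = coeffSeries F 0 := by
  ext m
  simp [coeffSeries, add_mul, mul_assoc]

theorem qBinomSeries_zero (q x : K) : qBinomSeries q x 0 = 1 := by
  ext i
  cases i with
  | zero => simp [qBinomSeries]
  | succ i => simp [qBinomSeries, qBinom_eq_zero, coeff_one]

theorem qGeomSeries_zero (q : K) : qGeomSeries q 0 = 1 := by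
  ext i
  cases i with
  | zero => simp [qGeomSeries]
  | succ i => simp [qGeomSeries, qBinom_eq_zero, coeff_one]

theorem evenSeries_zero (q a b c : K) : evenSeries q a b c 0 = mk fun _ => 1 := by
  ext i
  rw [evenSeries, qGeomSeries_zero, qBinomSeries_zero, qBinomSeries_zero]
  simp [qGeomSeries]

theorem coeff_zero_evenSeries (q a b c : K) (m : ℕ) : coeff 0 (evenSeries q a b c m) = 1 := by
  simp only [evenSeries, coeff_zero_mul_eq, coeff_rescale, qBinomSeries, qGeomSeries, coeff_mk]
  simp

/-- The coefficient of `z^(N+1)` in `one_sub_X_mul_evenSeries_succ`. That identity concerns `m + 1`;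
the remaining constant terms in `y` agree because `p_0 = 1 / (1 - z)`. -/
theorem coeffSeries_evenSeries_succ {q a b c d : K} (hq : q = a * b * c * d) (N : ℕ) :
    coeffSeries (evenSeries q a b c) (N + 1) =
      (1 - C (a * c * q ^ N) * X) * coeffSeries (evenSeries q a b c) N +
      C ((a * b) ^ (N + 1)) * X * (coeffSeries (oddSeries q c d a) (N + 1)
        + C c * coeffSeries (oddSeries q c d a) N)
      + C (a * (a * b) ^ N * (1 + c)) * X * coeffSeries (oddSeries q c d a) N := by
  ext m
  simp only [sub_mul, one_mul, mul_assoc, map_add, map_sub, coeff_C_mul]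
  cases m with
  | zero => simp [coeffSeries, evenSeries_zero]
  | succ m =>
    have h := congrArg (coeff (N + 1)) (one_sub_X_mul_evenSeries_succ hq m)
    simp only [sub_mul, add_mul, one_mul, mul_assoc, map_sub, map_add, coeff_C_mul,
      coeff_succ_X_mul, coeff_rescale] at h
    simp only [coeff_succ_X_mul, coeffSeries, coeff_mk, map_add, coeff_C_mul]
    linear_combination h

theorem coeffSeries_evenSeries_zero (q a b c : K) :
    coeffSeries (evenSeries q a b c) 0 = mk fun _ => 1 := by
  ext m
  rw [coeffSeries, coeff_mk, coeff_mk, coeff_zero_evenSeries]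

theorem phiEvenEven_zero (q a b c : K) : phiEvenEven q a b c 0 = mk fun _ => 1 := by
  rw [phiEvenEven, coeffSeries_evenSeries_zero, qGeomSeries_zero, map_one, mul_one]

theorem phiEvenOdd_zero {q a b c d : K} (hq : q = a * b * c * d) :
    phiEvenOdd q a b c 0 = mk fun _ => 1 := by
  rw [phiEvenOdd, coeffSeries_one_add_mul_zero, coeffSeries_oddSeries_zero hq,
    coeffSeries_evenSeries_zero, qGeomSeries_zero, map_one, mul_one]

/-- The row recursion from `Φ_(2N,2M+1)` to `Φ_(2N+1,2M+1)`. Since the bar is an involution,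
`bar Φ_(2N+1,2M)` involves only `bar p` and `t`, and the relation reduces to
`(1 - z) t_m(z) = bar p_m(abz)`. -/
theorem phiOddOdd_eq {q a b c d : K} (hq : q = a * b * c * d) (N : ℕ) :
    phiOddOdd q a b c N =
      phiEvenOdd q a b c N + C (a * (a * b) ^ N) * phiOddEven q c d a b N := by
  have hX := rescale_qGeomSeries_eq q (a * c) N
  have hqN : q ^ N = (a * b) ^ N * (c * d) ^ N := by rw [← mul_pow, hq]; ring
  rw [phiOddEven, phiEvenOdd, phiEvenEven, phiOddOdd, mul_comm c a, hX, hqN]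
  cases N with
  | zero =>
    rw [coeffSeries_one_add_mul_zero, coeffSeries_oddSeries_zero hq]
    simp only [map_mul, map_add, map_one, pow_zero]
    ring
  | succ N =>
    rw [coeffSeries_one_add_mul_succ]
    simp only [map_mul, map_add, map_one]
    have h := coeffSeries_oddSeries_succ hq N
    linear_combination (C a *
      (1 - C a * C c * (C ((a * b) ^ (N + 1)) * C ((c * d) ^ (N + 1))) * X) *
      rescale (a * c) (qGeomSeries q (N + 1 + 1))) * h

theorem phiEvenOdd_succ {q a b c d : K} (hq : q = a * b * c * d) (N : ℕ) :
    phiEvenOdd q a b c (N + 1) =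
      phiOddOdd q a b c N + C ((a * b) ^ (N + 1)) * phiEvenEven q c d a (N + 1) := by
  rw [phiEvenOdd, phiEvenEven, phiOddOdd, mul_comm c a, coeffSeries_one_add_mul_succ,
    coeffSeries_oddSeries_succ hq, map_add, map_one]
  ring

theorem phiEvenEven_succ {q a b c d : K} (hq : q = a * b * c * d) (N : ℕ) :
    phiEvenEven q a b c (N + 1) =
      phiOddEven q a b c d N + C ((a * b) ^ (N + 1)) * X * phiEvenOdd q c d a (N + 1) := by
  have hX := rescale_qGeomSeries_eq q (a * c) N
  rw [phiOddEven, phiEvenOdd, phiEvenEven, phiEvenEven, phiOddOdd, mul_comm c a,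
    coeffSeries_one_add_mul_succ, coeffSeries_evenSeries_succ hq, hX]
  simp only [map_mul, map_add, map_one]
  ring

/-- Passage from at most `2M` rows (when `R = 2M`) to at most `2M + 1` rows. -/
theorem boundedPhi_eq_coeff_odd {q : K} {R M : ℕ}
    (h : ∀ a b c d : K, q = a * b * c * d → ∀ N,
      boundedPhi (2 * N) R a b c d = coeff M (phiEvenEven q a b c N) ∧
      boundedPhi (2 * N + 1) R a b c d = coeff M (phiOddEven q a b c d N))
    (a b c d : K) (hq : q = a * b * c * d) (N : ℕ) :
    boundedPhi (2 * N) (R + 1) a b c d = coeff M (phiEvenOdd q a b c N) ∧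
      boundedPhi (2 * N + 1) (R + 1) a b c d = coeff M (phiOddOdd q a b c N) := by
  have h' := h c d a b (by rw [hq]; ring)
  have key : ∀ N, boundedPhi (2 * N) (R + 1) a b c d = coeff M (phiEvenOdd q a b c N) →
      boundedPhi (2 * N + 1) (R + 1) a b c d = coeff M (phiOddOdd q a b c N) := fun N hN => by
    rw [boundedPhi_odd_succ, phiOddOdd_eq hq, map_add, coeff_C_mul, hN, (h' N).2]
  have key' : boundedPhi (2 * N) (R + 1) a b c d = coeff M (phiEvenOdd q a b c N) := by
    induction N with
    | zero => rw [mul_zero, boundedPhi_zero_left, phiEvenOdd_zero hq, coeff_mk]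
    | succ N ih =>
      rw [boundedPhi_even_succ, phiEvenOdd_succ hq, map_add, coeff_C_mul, key N ih, (h' _).1]
  exact ⟨key', key N key'⟩

/-- Passage from at most `2M + 1` rows (when `R = 2M + 1`) to at most `2M + 2` rows. -/
theorem boundedPhi_eq_coeff_even_succ {q : K} {R M : ℕ}
    (h : ∀ a b c d : K, q = a * b * c * d → ∀ N,
      boundedPhi (2 * N) R a b c d = coeff M (phiEvenOdd q a b c N) ∧
      boundedPhi (2 * N + 1) R a b c d = coeff M (phiOddOdd q a b c N))
    (a b c d : K) (hq : q = a * b * c * d) (N : ℕ) :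
    boundedPhi (2 * N) (R + 1) a b c d = coeff (M + 1) (phiEvenEven q a b c N) ∧
      boundedPhi (2 * N + 1) (R + 1) a b c d = coeff (M + 1) (phiOddEven q a b c d N) := by
  have h' := h c d a b (by rw [hq]; ring)
  have key : ∀ N, boundedPhi (2 * N) (R + 1) a b c d = coeff (M + 1) (phiEvenEven q a b c N) →
      boundedPhi (2 * N + 1) (R + 1) a b c d = coeff (M + 1) (phiOddEven q a b c d N) :=
    fun N hN => by
      rw [boundedPhi_odd_succ, phiOddEven, map_add, mul_assoc (C _), coeff_C_mul,
        coeff_succ_X_mul, hN,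
        (h' N).2]
  have key' : boundedPhi (2 * N) (R + 1) a b c d = coeff (M + 1) (phiEvenEven q a b c N) := by
    induction N with
    | zero => rw [mul_zero, boundedPhi_zero_left, phiEvenEven_zero, coeff_mk]
    | succ N ih =>
      rw [boundedPhi_even_succ, phiEvenEven_succ hq, map_add, mul_assoc (C _), coeff_C_mul,
        coeff_succ_X_mul, key N ih, (h' _).1]
  exact ⟨key', key N key'⟩

theorem boundedPhi_eq_coeff_even {q : K} (M : ℕ) (a b c d : K) (hq : q = a * b * c * d) (N : ℕ) :
    boundedPhi (2 * N) (2 * M) a b c d = coeff M (phiEvenEven q a b c N) ∧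
      boundedPhi (2 * N + 1) (2 * M) a b c d = coeff M (phiOddEven q a b c d N) := by
  induction M generalizing a b c d N with
  | zero =>
    have h : coeff 0 (phiEvenEven q a b c N) = 1 := by
      rw [phiEvenEven, coeff_zero_mul_eq, coeff_rescale, coeffSeries, coeff_mk, evenSeries_zero,
        coeff_mk, qGeomSeries, coeff_mk]
      simp
    rw [mul_zero, boundedPhi_zero_right, boundedPhi_zero_right, phiOddEven, map_add, h]
    simp [mul_assoc]
  | succ M ih =>
    exact boundedPhi_eq_coeff_even_succ (boundedPhi_eq_coeff_odd ih) a b c d hq N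

/-! ### Extraction of coefficients -/

theorem one_add_mul_oddSeries (q a b c : K) (m : ℕ) :
    (1 + C a * X) * oddSeries q a b c m = qBinomSeries q a (m + 1) * qGeomSeries q (m + 1) *
      rescale (a * b) (qBinomSeries q c m * qGeomSeries q (m + 1)) := by
  rw [oddSeries, qBinomSeries_succ]
  ring

theorem coeff_coeffSeries_mul_rescale (F : ℕ → K⟦X⟧) (q x : K) (N s M : ℕ) :
    coeff M (coeffSeries F N * rescale x (qGeomSeries q s)) =
      ∑ k ∈ Finset.range (M + 1), x ^ k * qBinom q (s + k - 1) k * coeff N (F (M - k)) := by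
  rw [mul_comm, coeff_mul, Finset.Nat.sum_antidiagonal_eq_sum_range_succ
    fun i j => coeff i (rescale x (qGeomSeries q s)) * coeff j (coeffSeries F N)]
  simp only [coeff_rescale, qGeomSeries, coeffSeries, coeff_mk]

theorem coeff_mul_rescale (F G : K⟦X⟧) (y : K) (N : ℕ) :
    coeff N (F * rescale y G) =
      ∑ j ∈ Finset.range (N + 1), y ^ (N - j) * coeff j F * coeff (N - j) G := by
  rw [coeff_mul, Finset.Nat.sum_antidiagonal_eq_sum_range_succ
    fun i j => coeff i F * coeff j (rescale y G)]
  refine Finset.sum_congr rfl fun j _ => ?_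
  rw [coeff_rescale]
  ring

theorem coeff_qBinomSeries_mul_qGeomSeries (q x : K) (n s j : ℕ) :
    coeff j (qBinomSeries q x n * qGeomSeries q s) = ∑ i ∈ Finset.range (j + 1),
      x ^ i * q ^ (i.choose 2) * qBinom q n i * qBinom q (s + (j - i) - 1) (j - i) := by
  rw [coeff_mul, Finset.Nat.sum_antidiagonal_eq_sum_range_succ
    fun i j => coeff i (qBinomSeries q x n) * coeff j (qGeomSeries q s)]
  simp only [qBinomSeries, qGeomSeries, coeff_mk]

/-- The theorem before the expansion of the products, valid for every `Q`. The power
`Q ^ (ν * μ)` accounts for `(-aQz)_m` in the odd-odd case; in the even-odd case the factor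
`(1 + az)` turns `(-aQz)_m` into `(-az)_(m+1)`. -/
theorem boundedPhi_eq_sum (a b c d Q : K) (hQ : Q = a * b * c * d)
    (N M ν μ : ℕ) (hν : ν = 0 ∨ ν = 1) (hμ : μ = 0 ∨ μ = 1) (hνμ : (ν, μ) ≠ (1, 0)) :
    boundedPhi (2 * N + ν) (2 * M + μ) a b c d =
      ∑ k ∈ Finset.range (M + 1), (a * c) ^ k * qBinom Q (N + k + ν - 1) k *
        ((1 + (ν : K) * (μ : K) * a) * coeff N
          (qBinomSeries Q (Q ^ (ν * μ) * a) (M - k + μ - ν) * qGeomSeries Q (M - k + 1) *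
            rescale (a * b) (qBinomSeries Q c (M - k) * qGeomSeries Q (M - k + μ)))) := by
  have he := fun a b c d hq N => boundedPhi_eq_coeff_even (q := Q) M a b c d hq N
  have ho := boundedPhi_eq_coeff_odd he a b c d hQ N
  rcases hν with rfl | rfl <;> rcases hμ with rfl | rfl
  · rw [add_zero, add_zero, (he a b c d hQ N).1, phiEvenEven, coeff_coeffSeries_mul_rescale]
    simp [evenSeries]
  · rw [add_zero, ho.1, phiEvenOdd, coeff_coeffSeries_mul_rescale]
    simp [one_add_mul_oddSeries]
  · exact absurd rfl hνμ
  · rw [ho.2, phiOddOdd, mul_assoc, coeff_C_mul, coeff_coeffSeries_mul_rescale, Finset.mul_sum]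
    refine Finset.sum_congr rfl fun k _ => ?_
    rw [show N + k + 1 - 1 = N + 1 + k - 1 by omega]
    simp only [oddSeries, Nat.add_sub_cancel, mul_one, pow_one, Nat.cast_one, one_mul]
    ring

end

theorem mainTheorem10 {K : Type*} [Field K] (a b c d Q : K) (hQ : Q = a * b * c * d)
    (N M ν μ : ℕ) (hν : ν = 0 ∨ ν = 1) (hμ : μ = 0 ∨ μ = 1)
    (hνμ : (ν, μ) ≠ (1, 0)) (hN : 0 < 2 * N + ν) (hM : 0 < 2 * M + μ)
    (hroot : ∀ n : ℕ, 1 ≤ n → n ≤ N + M → Q ^ n ≠ 1) :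
    boundedPhi (2 * N + ν) (2 * M + μ) a b c d =
      ∑ k ∈ Finset.range (M + 1), (a * c) ^ k * gaussBinom Q (N + k + ν - 1) k *
        ∑ j ∈ Finset.range (N + 1), (a * b) ^ (N - j) *
          (∑ m₁ ∈ Finset.range (j + 1),
            (1 + (ν : K) * (μ : K) * a) * a ^ m₁ * Q ^ (m₁.choose 2 + ν * μ * m₁) *
              gaussBinom Q (M - k + μ - ν) m₁ * gaussBinom Q (M - k + j - m₁) (j - m₁)) *
          (∑ m₂ ∈ Finset.range (N - j + 1),
            c ^ m₂ * Q ^ (m₂.choose 2) * gaussBinom Q (M - k) m₂ *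
              (qPoch (Q ^ (M - k + μ)) Q (N - j - m₂) / qPoch Q Q (N - j - m₂))) := by
  rw [boundedPhi_eq_sum a b c d Q hQ N M ν μ hν hμ hνμ]
  refine Finset.sum_congr rfl fun k hk => ?_
  have hk : k ≤ M := by simpa [Nat.lt_succ_iff] using hk
  rw [gaussBinom_eq_qBinom k fun i hi hi' => hroot i hi (by omega), coeff_mul_rescale,
    Finset.mul_sum]
  refine congrArg _ (Finset.sum_congr rfl fun j hj => ?_)
  have hj : j ≤ N := by simpa [Nat.lt_succ_iff] using hj
  rw [coeff_qBinomSeries_mul_qGeomSeries, coeff_qBinomSeries_mul_qGeomSeries]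
  have h₁ : ∑ m₁ ∈ Finset.range (j + 1),
      (1 + (ν : K) * (μ : K) * a) * a ^ m₁ * Q ^ (m₁.choose 2 + ν * μ * m₁) *
        gaussBinom Q (M - k + μ - ν) m₁ * gaussBinom Q (M - k + j - m₁) (j - m₁) =
      (1 + (ν : K) * (μ : K) * a) * ∑ m₁ ∈ Finset.range (j + 1),
        (Q ^ (ν * μ) * a) ^ m₁ * Q ^ (m₁.choose 2) * qBinom Q (M - k + μ - ν) m₁ *
          qBinom Q (M - k + 1 + (j - m₁) - 1) (j - m₁) := by
    rw [Finset.mul_sum]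
    refine Finset.sum_congr rfl fun m₁ hm => ?_
    have hm : m₁ ≤ j := by simpa [Nat.lt_succ_iff] using hm
    rw [gaussBinom_eq_qBinom _ fun i hi hi' => hroot i hi (by omega),
      gaussBinom_eq_qBinom _ fun i hi hi' => hroot i hi (by omega),
      show M - k + 1 + (j - m₁) - 1 = M - k + j - m₁ by omega, mul_pow, ← pow_mul, pow_add]
    ring
  have h₂ : ∑ m₂ ∈ Finset.range (N - j + 1), c ^ m₂ * Q ^ (m₂.choose 2) *
        gaussBinom Q (M - k) m₂ *
          (qPoch (Q ^ (M - k + μ)) Q (N - j - m₂) / qPoch Q Q (N - j - m₂)) =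
      ∑ m₂ ∈ Finset.range (N - j + 1), c ^ m₂ * Q ^ (m₂.choose 2) * qBinom Q (M - k) m₂ *
        qBinom Q (M - k + μ + (N - j - m₂) - 1) (N - j - m₂) := by
    refine Finset.sum_congr rfl fun m₂ _ => ?_
    rw [gaussBinom_eq_qBinom _ fun i hi hi' => hroot i hi (by omega),
      qPoch_div_eq_qBinom fun i hi hi' => hroot i hi (by omega)]
  rw [h₁, h₂]
  ring
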